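/- Let $\{B_v\}_{v\in V}$ be an infinite family of pairwise disjoint open disks of diameter $1$ in the Euclidean plane $\mathbb R^2$, with centers $c_v$. Its penny graph is the (locally finite, simple) graph on $V$ in which $v\sim w$ if and only if the boundary circles of $B_v$ and $B_w$ are tangent, i.e. $|c_v-c_w|=1$. It is embedded in the plane by drawing each vertex $v$ at $c_v$ and each edge as the straight segment joining the two centers. The faces are the connected components of the complement of the embedded graph. The facial degree $\deg(\sigma)\in\mathbb N\cup\{\infty\}$ of a face $\sigma$ is its number of corners (interior angles, those of size at least $\pi$ included): for each vertex $v$, the edges at $v$ cut the disk $B_v$ into sectors, and the corners of $\sigma$ at $v$ are the sectors contained in $\sigma$. Assume that the penny graph is connected and has bounded facial degree, that is, $\sup_\sigma\deg(\sigma)<\infty$. Then: 1. The simple random walk on the graph (which at each step moves to a uniformly chosen neighbor) is recurrent: started at any vertex, it almost surely returns to that vertex at some time $n\ge 1$. 2. Every positive superharmonic function is constant: if $f:V\to(0,\infty)$ satisfies $\Delta f(x):=\sum_{y\sim x}(f(y)-f(x))\le 0$ for all $x\in V$, then $f$ is constant. -/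

import Mathlib

/-- The Euclidean plane. -/
abbrev Plane : Type := EuclideanSpace ℝ (Fin 2)

/-- A collection of non-overlapping pennies indexed by `V`: open disks of diameter `1` in the plane,
given by their centers, which are pairwise disjoint. -/
structure PennyConfiguration (V : Type*) where
  center : V → Plane
  disjoint_pennies : ∀ i j, i ≠ j →
    Disjoint (Metric.ball (center i) (1 / 2)) (Metric.ball (center j) (1 / 2))

namespace PennyConfiguration

variable {V : Type*} (P : PennyConfiguration V)

/-- The open disk represented by the vertex `v`. -/
def penny (v : V) : Set Plane := Metric.ball (P.center v) (1 / 2)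

/-- The contact graph. Two distinct non-overlapping circles of radius `1 / 2` are tangent to each
other iff their centers are at distance `1`. -/
def graph : SimpleGraph V where
  Adj i j := dist (P.center i) (P.center j) = 1
  symm := ⟨fun i j h => by rw [dist_comm]; exact h⟩
  loopless := ⟨fun i h => by simp at h⟩

theorem one_le_dist {i j : V} (h : i ≠ j) : 1 ≤ dist (P.center i) (P.center j) := by
  have := (disjoint_ball_ball_iff (by norm_num) (by norm_num)).1 (P.disjoint_pennies i j h)
  linarith

theorem finite_neighborSet (v : V) : (P.graph.neighborSet v).Finite := by
  obtain ⟨t, -, ht, hcov⟩ := (isCompact_closedBall (P.center v) 1).finite_cover_balls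
    (e := (1 / 2 : ℝ)) (by norm_num)
  have key : ∀ w : V, w ∈ P.graph.neighborSet v →
      ∃ c ∈ t, dist (P.center w) c < 1 / 2 := by
    intro w hw
    have hw' : dist (P.center v) (P.center w) = 1 := hw
    have : P.center w ∈ Metric.closedBall (P.center v) 1 := by
      rw [Metric.mem_closedBall, dist_comm, hw']
    simpa using hcov this
  choose! g hg hgd using key
  refine Set.Finite.of_finite_image (f := g) (ht.subset ?_) ?_
  · rintro _ ⟨w, hw, rfl⟩
    exact hg w hw
  · intro w hw w' hw' h
    by_contra hne
    have h1 := P.one_le_dist hne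
    have h2 := hgd w hw
    have h3 := hgd w' hw'
    rw [← h] at h3
    have h4 := dist_triangle_right (P.center w) (P.center w') (g w)
    linarith

/-- The contact graph is locally finite. -/
noncomputable instance instLocallyFiniteGraph : P.graph.LocallyFinite :=
  fun v => (P.finite_neighborSet v).fintype

/-- The image of the geometric embedding of the contact graph in the plane: the centers of the
pennies together with the segments joining the centers of tangent pennies. -/
def embeddingImage : Set Plane :=
  Set.range P.center ∪
    ⋃ (i : V) (j : V) (_ : P.graph.Adj i j), segment ℝ (P.center i) (P.center j)

/-- The faces: the connected components of the complement of the embedding image. -/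
def faces : Set (Set Plane) :=
  {σ | ∃ z ∈ P.embeddingImageᶜ, σ = connectedComponentIn P.embeddingImageᶜ z}

/-- The corners (interior angles) of `σ`. The edges at `v` cut the penny of `v` into
circular sectors (no other edge or vertex meets this penny), which are the connected components of
the penny minus the embedding image; a corner of `σ` at `v` is a sector of `v` lying in `σ`. A
vertex that the boundary of `σ` visits several times thus has several corners in `σ`, and interior
angles equal to or larger than `π` count as corners too. -/
def corners (σ : Set Plane) : Set (V × Set Plane) :=
  {c | (∃ z ∈ P.penny c.1 \ P.embeddingImage,
    c.2 = connectedComponentIn (P.penny c.1 \ P.embeddingImage) z) ∧ c.2 ⊆ σ}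

/-- The facial degree: the number of corners, possibly infinite. -/
noncomputable def facialDegree (σ : Set Plane) : ℕ∞ := (P.corners σ).encard

/-- The facial degrees are bounded by a finite number. -/
def HasBoundedFacialDegree : Prop := ∃ D : ℕ, ∀ σ ∈ P.faces, P.facialDegree σ ≤ D

end PennyConfiguration

namespace SimpleGraph

open MeasureTheory ProbabilityTheory

variable {V : Type*} (G : SimpleGraph V) [G.LocallyFinite]

/-- The combinatorial Laplacian. -/
noncomputable def combLaplacian (f : V → ℝ) (x : V) : ℝ :=
  ∑ y ∈ G.neighborFinset x, (f y - f x)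

/-- Superharmonic functions. -/
def IsSuperharmonic (f : V → ℝ) : Prop := ∀ x, G.combLaplacian f x ≤ 0

open Classical in
/-- One step of the simple random walk from `x`: a uniformly chosen neighbor of `x`. (At a vertex
without neighbors the walk stays; a connected graph with two or more vertices has none.) -/
noncomputable def walkStep (x : V) : PMF V :=
  if h : (G.neighborFinset x).Nonempty then PMF.uniformOfFinset (G.neighborFinset x) h
  else PMF.pure x

section Walk

variable [MeasurableSpace V] [DiscreteMeasurableSpace V]

/-- The law of the position at time `n + 1` given the positions up to time `n`. -/
noncomputable def walkKernel (n : ℕ) : Kernel (Π _ : Finset.Iic n, V) V where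
  toFun h := (G.walkStep (h ⟨n, Finset.mem_Iic.2 le_rfl⟩)).toMeasure
  measurable' :=
    (Measurable.of_discrete (f := fun x => (G.walkStep x).toMeasure)).comp (measurable_pi_apply _)

instance instIsMarkovKernelWalkKernel (n : ℕ) : IsMarkovKernel (G.walkKernel n) :=
  ⟨fun h => PMF.toMeasure.isProbabilityMeasure
    (G.walkStep (h ⟨n, Finset.mem_Iic.2 le_rfl⟩))⟩

/-- The law, on the space of trajectories `ℕ → V`, of the simple random walk started at `x`. -/
noncomputable def walkLaw (x : V) : Measure (ℕ → V) :=
  Kernel.traj (X := fun _ => V) (fun n => G.walkKernel n) 0 (fun _ => x)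

end Walk

/-- The simple random walk is recurrent: from every vertex, it almost surely returns there. -/
def IsRecurrent : Prop :=
  letI : MeasurableSpace V := ⊤
  haveI : DiscreteMeasurableSpace V := ⟨fun _ => trivial⟩
  ∀ x : V, ∀ᵐ ω ∂(G.walkLaw x), ∃ n : ℕ, 1 ≤ n ∧ ω n = x

end SimpleGraph

/-!
A `δ`-separated family of points in dimension at most `2` has `O (r ^ 2)` members at distance at
most `r` from the origin. If edges also have bounded length, the logarithmic cutoffs
`max 0 (1 - log (1 + ‖c x‖) / n)` have Dirichlet energy `O (1 / n)`: each of the `n` annuli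
`exp k ≤ 1 + ‖c x‖ ≤ exp (k + 1)` contributes `O (1 / n ^ 2)`.

If `f` is positive and superharmonic, the ground state transform bounds the energy of `φ` from below
by the energy of `φ / f` with edge weights `f x * f y`. As `φ` runs through the cutoffs, the upper
bound tends to `0` while `φ / f` tends to `1 / f`, so `f` takes equal values at adjacent vertices.

Let `q x` be the probability that the walk started at `x` never visits `o` at a positive time, and
set `q' x = q x` for `x ≠ o` and `q' o = 0`. By the Markov property `q x` is the mean of `q'` over
the neighbors of `x`, so that `2 - q'` is positive and superharmonic, hence constant. Then `q' = 0`,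
and averaging once more gives `q o = 0`.
-/

section DirichletEnergy

open Filter Topology Function

variable {V : Type*} {G : SimpleGraph V}

theorem tsum_dart_swap (F : V → V → ℝ) :
    ∑' d : G.Dart, F d.snd d.fst = ∑' d : G.Dart, F d.fst d.snd :=
  (SimpleGraph.Dart.symm_involutive.toPerm _).tsum_eq fun d : G.Dart => F d.fst d.snd

/-- The Dirichlet energy of `φ`. The sum runs over oriented edges, so every edge counts twice; it
has finitely many nonzero terms when `φ` is finitely supported and the graph is locally finite. -/
noncomputable def dirichletEnergy (G : SimpleGraph V) (φ : V → ℝ) : ℝ :=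
  ∑' d : G.Dart, (φ d.fst - φ d.snd) ^ 2

/-- A parabolic graph: one on which the constant `1` is a pointwise limit of finitely supported
functions with vanishing Dirichlet energies. -/
def IsParabolic (G : SimpleGraph V) : Prop :=
  ∃ φ : ℕ → V → ℝ, (∀ n, (support (φ n)).Finite) ∧
    (∀ x, Tendsto (fun n => φ n x) atTop (𝓝 1)) ∧
    Tendsto (fun n => dirichletEnergy G (φ n)) atTop (𝓝 0)

variable [G.LocallyFinite]

theorem tsum_dart_eq_tsum_sum_neighborFinset {F : V → V → ℝ}
    (hF : Summable fun d : G.Dart => F d.fst d.snd) :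
    ∑' d : G.Dart, F d.fst d.snd = ∑' x, ∑ y ∈ G.neighborFinset x, F x y := by
  let e : (Σ x, G.neighborSet x) ≃ G.Dart :=
    { toFun := fun p => G.dartOfNeighborSet p.1 p.2
      invFun := fun d => ⟨d.fst, d.snd, d.adj⟩
      left_inv := fun _ => rfl
      right_inv := fun _ => rfl }
  have hFe : Summable fun p : Σ x, G.neighborSet x => F p.1 p.2 := e.summable_iff.2 hF
  calc ∑' d : G.Dart, F d.fst d.snd
      = ∑' p : Σ x, G.neighborSet x, F p.1 p.2 :=
        (e.tsum_eq fun d : G.Dart => F d.fst d.snd).symm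
    _ = ∑' x, ∑' y : G.neighborSet x, F x y := hFe.tsum_sigma
    _ = ∑' x, ∑ y ∈ G.neighborFinset x, F x y := tsum_congr fun x => by
        rw [tsum_fintype, SimpleGraph.neighborFinset, ← Finset.sum_set_coe]

theorem finite_dart_fst_mem {S : Set V} (hS : S.Finite) : {d : G.Dart | d.fst ∈ S}.Finite := by
  refine (hS.biUnion fun x _ => Set.finite_range (G.dartOfNeighborSet x)).subset fun d hd => ?_
  exact Set.mem_biUnion hd ⟨⟨d.snd, d.adj⟩, rfl⟩

theorem finite_dart_mem_or_mem {S : Set V} (hS : S.Finite) :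
    {d : G.Dart | d.fst ∈ S ∨ d.snd ∈ S}.Finite :=
  (finite_dart_fst_mem hS).union <| (finite_dart_fst_mem hS).preimage (f := SimpleGraph.Dart.symm)
    SimpleGraph.Dart.symm_involutive.injective.injOn

theorem summable_dart_of_finite_support {g : V → ℝ} (hg : (support g).Finite) {F : G.Dart → ℝ}
    (hF : ∀ d, g d.fst = 0 → g d.snd = 0 → F d = 0) : Summable F := by
  refine summable_of_hasFiniteSupport ((finite_dart_mem_or_mem hg).subset fun d hd => ?_)
  by_contra! hd0
  simp only [Set.mem_ofPred_eq, mem_support, not_or, not_not] at hd0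
  exact hd (hF d hd0.1 hd0.2)

theorem tsum_dart_fst_eq_sum_degree_mul {h : V → ℝ} {s : Finset V} (hs : ∀ x ∉ s, h x = 0) :
    ∑' d : G.Dart, h d.fst = ∑ x ∈ s, G.degree x * h x := by
  have hsupp : (support h).Finite := s.finite_toSet.subset fun x hx => by
    by_contra hxs
    exact hx (hs x hxs)
  rw [tsum_dart_eq_tsum_sum_neighborFinset (F := fun x _ => h x)
    (summable_dart_of_finite_support hsupp fun _ h₀ _ => h₀)]
  simp only [Finset.sum_const, SimpleGraph.card_neighborFinset_eq_degree, nsmul_eq_mul]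
  exact tsum_eq_sum fun x hx => by rw [hs x hx, mul_zero]

theorem tsum_dart_sub_mul_sub_eq_neg_two_mul_tsum (f : V → ℝ) {g : V → ℝ}
    (hg : (support g).Finite) :
    ∑' d : G.Dart, (f d.fst - f d.snd) * (g d.fst - g d.snd) =
      -2 * ∑' x, g x * G.combLaplacian f x := by
  have hfst : Summable fun d : G.Dart => (f d.fst - f d.snd) * g d.fst :=
    summable_dart_of_finite_support hg fun d h _ => by simp only [h, mul_zero]
  have hsnd : Summable fun d : G.Dart => (f d.snd - f d.fst) * g d.snd :=
    summable_dart_of_finite_support hg fun d _ h => by simp only [h, mul_zero]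
  calc ∑' d : G.Dart, (f d.fst - f d.snd) * (g d.fst - g d.snd)
      = ∑' d : G.Dart, ((f d.fst - f d.snd) * g d.fst + (f d.snd - f d.fst) * g d.snd) :=
        tsum_congr fun d => by ring
    _ = 2 * ∑' d : G.Dart, (f d.fst - f d.snd) * g d.fst := by
        rw [hfst.tsum_add hsnd, tsum_dart_swap fun x y => (f x - f y) * g x, two_mul]
    _ = -2 * ∑' x, g x * G.combLaplacian f x := by
        rw [tsum_dart_eq_tsum_sum_neighborFinset (F := fun x y => (f x - f y) * g x) hfst,
          neg_mul, ← mul_neg, ← tsum_neg]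
        congr! 3 with x
        rw [SimpleGraph.combLaplacian, ← mul_neg, ← Finset.sum_neg_distrib, Finset.mul_sum]
        exact Finset.sum_congr rfl fun y _ => by ring

/-- The ground state transform; it is Green's formula for `f` and `φ ^ 2 / f`. -/
theorem dirichletEnergy_eq_tsum_dart_sub {f : V → ℝ} (hf : ∀ x, f x ≠ 0) {φ : V → ℝ}
    (hφ : (support φ).Finite) :
    dirichletEnergy G φ =
      ∑' d : G.Dart, f d.fst * f d.snd * (φ d.fst / f d.fst - φ d.snd / f d.snd) ^ 2 -
        2 * ∑' x, φ x ^ 2 / f x * G.combLaplacian f x := by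
  have hg : (support fun x => φ x ^ 2 / f x).Finite :=
    hφ.subset fun x hx h0 => hx (by simp [h0])
  have hweighted : Summable fun d : G.Dart =>
      f d.fst * f d.snd * (φ d.fst / f d.fst - φ d.snd / f d.snd) ^ 2 :=
    summable_dart_of_finite_support hφ fun d h h' => by simp [h, h']
  have hmixed : Summable fun d : G.Dart =>
      (f d.fst - f d.snd) * (φ d.fst ^ 2 / f d.fst - φ d.snd ^ 2 / f d.snd) :=
    summable_dart_of_finite_support hφ fun d h h' => by simp [h, h']
  rw [sub_eq_add_neg, ← neg_mul, ← tsum_dart_sub_mul_sub_eq_neg_two_mul_tsum f hg,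
    ← hweighted.tsum_add hmixed]
  refine tsum_congr fun d => ?_
  have h₁ := hf d.fst
  have h₂ := hf d.snd
  field_simp
  ring

theorem tsum_dart_le_dirichletEnergy_of_isSuperharmonic {f : V → ℝ} (hf : G.IsSuperharmonic f)
    (hpos : ∀ x, 0 < f x) {φ : V → ℝ} (hφ : (support φ).Finite) :
    ∑' d : G.Dart, f d.fst * f d.snd * (φ d.fst / f d.fst - φ d.snd / f d.snd) ^ 2 ≤
      dirichletEnergy G φ := by
  rw [dirichletEnergy_eq_tsum_dart_sub (fun x => (hpos x).ne') hφ]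
  have : ∑' x, φ x ^ 2 / f x * G.combLaplacian f x ≤ 0 :=
    tsum_nonpos fun x => mul_nonpos_of_nonneg_of_nonpos
      (div_nonneg (sq_nonneg _) (hpos x).le) (hf x)
  linarith

theorem mul_mul_sq_le_dirichletEnergy_of_isSuperharmonic {f : V → ℝ} (hf : G.IsSuperharmonic f)
    (hpos : ∀ x, 0 < f x) {φ : V → ℝ} (hφ : (support φ).Finite) {x y : V} (hxy : G.Adj x y) :
    f x * f y * (φ x / f x - φ y / f y) ^ 2 ≤ dirichletEnergy G φ := by
  refine le_trans ?_ (tsum_dart_le_dirichletEnergy_of_isSuperharmonic hf hpos hφ)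
  exact (summable_dart_of_finite_support hφ fun d h h' => by simp [h, h']).le_tsum
    (f := fun d : G.Dart => f d.fst * f d.snd * (φ d.fst / f d.fst - φ d.snd / f d.snd) ^ 2)
    ⟨(x, y), hxy⟩ fun d _ => mul_nonneg (mul_pos (hpos _) (hpos _)).le (sq_nonneg _)

namespace IsParabolic

theorem eq_of_adj_of_isSuperharmonic (hG : IsParabolic G) {f : V → ℝ} (hf : G.IsSuperharmonic f)
    (hpos : ∀ x, 0 < f x) {x y : V} (hxy : G.Adj x y) : f x = f y := by
  obtain ⟨φ, hfin, hone, henergy⟩ := hG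
  have hlim : Tendsto (fun n => f x * f y * (φ n x / f x - φ n y / f y) ^ 2) atTop
      (𝓝 (f x * f y * (1 / f x - 1 / f y) ^ 2)) :=
    ((((hone x).div_const _).sub ((hone y).div_const _)).pow 2).const_mul _
  have hnonpos : f x * f y * (1 / f x - 1 / f y) ^ 2 ≤ 0 :=
    le_of_tendsto_of_tendsto' hlim henergy fun n =>
      mul_mul_sq_le_dirichletEnergy_of_isSuperharmonic hf hpos (hfin n) hxy
  have hsq : (1 / f x - 1 / f y) ^ 2 ≤ 0 :=
    nonpos_of_mul_nonpos_right hnonpos (mul_pos (hpos x) (hpos y))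
  have hinv : 1 / f x = 1 / f y := sub_eq_zero.1 (pow_eq_zero_iff two_ne_zero |>.1
    (le_antisymm hsq (sq_nonneg _)))
  simpa only [one_div, inv_inj] using hinv

theorem eq_of_isSuperharmonic (hG : IsParabolic G) (hconn : G.Preconnected) {f : V → ℝ}
    (hf : G.IsSuperharmonic f) (hpos : ∀ x, 0 < f x) (x y : V) : f x = f y := by
  obtain ⟨p⟩ := hconn x y
  induction p with
  | nil => rfl
  | cons hadj _ ih => exact (hG.eq_of_adj_of_isSuperharmonic hf hpos hadj).trans ih

end IsParabolic

end DirichletEnergy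

section QuadraticGrowth

open Filter Topology Function

variable {V : Type*}

/-- The logarithmic cutoff of a function `ρ ≥ 1`: it is supported where `ρ < exp n`, and its
Dirichlet energy is of order `1 / n` when `ρ` is a gauge of quadratic growth. -/
noncomputable def logCutoff (ρ : V → ℝ) (n : ℕ) (x : V) : ℝ := max 0 (1 - Real.log (ρ x) / n)

theorem tendsto_logCutoff (ρ : V → ℝ) (x : V) :
    Tendsto (fun n => logCutoff ρ n x) atTop (𝓝 1) := by
  have h : Tendsto (fun n : ℕ => max 0 (1 - Real.log (ρ x) / n)) atTop (𝓝 (max 0 (1 - 0))) :=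
    tendsto_const_nhds.max
      (tendsto_const_nhds.sub (tendsto_const_nhds.div_atTop tendsto_natCast_atTop_atTop))
  simpa only [logCutoff, sub_zero, zero_le_one, max_eq_right] using h

theorem logCutoff_eq_zero {ρ : V → ℝ} {n : ℕ} (hn : n ≠ 0) {x : V} (hx : Real.exp n ≤ ρ x) :
    logCutoff ρ n x = 0 := by
  have hlog : (n : ℝ) ≤ Real.log (ρ x) :=
    (Real.le_log_iff_exp_le ((Real.exp_pos _).trans_le hx)).2 hx
  have : 1 ≤ Real.log (ρ x) / n := (one_le_div (by positivity)).2 hlog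
  exact max_eq_left (by linarith)

theorem abs_logCutoff_sub_le {ρ : V → ℝ} {n : ℕ} {x y : V} (hx : 0 < ρ x) (hxy : ρ x ≤ ρ y) :
    |logCutoff ρ n x - logCutoff ρ n y| ≤ (ρ y - ρ x) / ρ x / n := by
  have hy : 0 < ρ y := hx.trans_le hxy
  have hlog : Real.log (ρ y) - Real.log (ρ x) ≤ (ρ y - ρ x) / ρ x := by
    rw [← Real.log_div hy.ne' hx.ne', sub_div, div_self hx.ne']
    exact Real.log_le_sub_one_of_pos (div_pos hy hx)
  calc |logCutoff ρ n x - logCutoff ρ n y|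
      ≤ |(1 - Real.log (ρ x) / n) - (1 - Real.log (ρ y) / n)| := by
        rw [logCutoff, logCutoff, max_comm 0, max_comm 0]
        exact abs_max_sub_max_le_abs _ _ _
    _ = (Real.log (ρ y) - Real.log (ρ x)) / n := by
        rw [sub_sub_sub_cancel_left, ← sub_div,
          abs_of_nonneg (div_nonneg (sub_nonneg.2 (Real.log_le_log hx hxy)) n.cast_nonneg)]
    _ ≤ (ρ y - ρ x) / ρ x / n := by gcongr

variable {G : SimpleGraph V} [G.LocallyFinite]

/-- A gauge of quadratic growth: a function `ρ ≥ 1` with finite sublevel sets which varies by at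
most `L` along edges and whose sublevel set `{ρ ≤ r}` has volume (sum of degrees) at most
`C * r ^ 2`. -/
structure IsQuadraticGauge (G : SimpleGraph V) [G.LocallyFinite] (ρ : V → ℝ) (L C : ℝ) :
    Prop where
  one_le : ∀ x, 1 ≤ ρ x
  abs_sub_le : ∀ x y, G.Adj x y → |ρ x - ρ y| ≤ L
  finite_le : ∀ r, {x | ρ x ≤ r}.Finite
  sum_degree_le : ∀ r, 1 ≤ r → ∀ s : Finset V, (∀ x ∈ s, ρ x ≤ r) →
    ∑ x ∈ s, (G.degree x : ℝ) ≤ C * r ^ 2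

namespace IsQuadraticGauge

variable {ρ : V → ℝ} {L C : ℝ}

theorem pos (hρ : IsQuadraticGauge G ρ L C) (x : V) : 0 < ρ x := one_pos.trans_le (hρ.one_le x)

theorem sum_degree_mul_inv_sq_le_of_annulus (hρ : IsQuadraticGauge G ρ L C) {k : ℕ} {s : Finset V}
    (hlow : ∀ x ∈ s, Real.exp k ≤ ρ x) (hup : ∀ x ∈ s, ρ x ≤ Real.exp (k + 1)) :
    ∑ x ∈ s, G.degree x * (ρ x ^ 2)⁻¹ ≤ C * Real.exp 1 ^ 2 := by
  calc ∑ x ∈ s, G.degree x * (ρ x ^ 2)⁻¹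
      ≤ ∑ x ∈ s, G.degree x * (Real.exp k ^ 2)⁻¹ := by
        gcongr with x hx
        exact hlow x hx
    _ = (∑ x ∈ s, (G.degree x : ℝ)) * (Real.exp k ^ 2)⁻¹ := (Finset.sum_mul ..).symm
    _ ≤ C * Real.exp (k + 1) ^ 2 * (Real.exp k ^ 2)⁻¹ := by
        gcongr
        exact hρ.sum_degree_le _ (Real.one_le_exp (by positivity)) s hup
    _ = C * Real.exp 1 ^ 2 := by
        rw [Real.exp_add]
        field_simp

theorem sum_degree_mul_inv_sq_le (hρ : IsQuadraticGauge G ρ L C) {n : ℕ} {s : Finset V}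
    (hs : ∀ x ∈ s, ρ x < Real.exp n) :
    ∑ x ∈ s, G.degree x * (ρ x ^ 2)⁻¹ ≤ n * (C * Real.exp 1 ^ 2) := by
  have hlog : ∀ x, 0 ≤ Real.log (ρ x) := fun x => Real.log_nonneg (hρ.one_le x)
  have hmaps : ∀ x ∈ s, ⌊Real.log (ρ x)⌋₊ ∈ Finset.range n := fun x hx => by
    rw [Finset.mem_range, Nat.floor_lt (hlog x)]
    exact (Real.log_lt_iff_lt_exp (hρ.pos x)).2 (hs x hx)
  rw [← Finset.sum_fiberwise_of_maps_to hmaps]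
  calc ∑ k ∈ Finset.range n, ∑ x ∈ s with ⌊Real.log (ρ x)⌋₊ = k, G.degree x * (ρ x ^ 2)⁻¹
      ≤ ∑ _k ∈ Finset.range n, C * Real.exp 1 ^ 2 := Finset.sum_le_sum fun k _ =>
        hρ.sum_degree_mul_inv_sq_le_of_annulus (k := k)
          (fun x hx => by
            rw [← Real.le_log_iff_exp_le (hρ.pos x), ← (Finset.mem_filter.1 hx).2]
            exact Nat.floor_le (hlog x))
          (fun x hx => by
            rw [← Real.log_le_iff_le_exp (hρ.pos x), ← (Finset.mem_filter.1 hx).2]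
            exact (Nat.lt_floor_add_one _).le)
    _ = n * (C * Real.exp 1 ^ 2) := by
        rw [Finset.sum_const, Finset.card_range, nsmul_eq_mul]

theorem finite_lt (hρ : IsQuadraticGauge G ρ L C) (r : ℝ) : {x | ρ x < r}.Finite :=
  (hρ.finite_le r).subset fun x (hx : ρ x < r) => hx.le

theorem finite_support_logCutoff (hρ : IsQuadraticGauge G ρ L C) {n : ℕ} (hn : n ≠ 0) :
    (support (logCutoff ρ n)).Finite :=
  (hρ.finite_lt (Real.exp n)).subset fun _ hx => not_le.1 fun hle => hx (logCutoff_eq_zero hn hle)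

theorem sq_logCutoff_sub_le_of_le (hρ : IsQuadraticGauge G ρ L C) {n : ℕ} (hn : n ≠ 0) {x y : V}
    (hadj : G.Adj x y) (hxy : ρ x ≤ ρ y) :
    (logCutoff ρ n x - logCutoff ρ n y) ^ 2 ≤
      (L / n) ^ 2 * {z | ρ z < Real.exp n}.indicator (fun z => (ρ z ^ 2)⁻¹) x := by
  by_cases hx : ρ x < Real.exp n
  · have hx0 := hρ.pos x
    have hL : ρ y - ρ x ≤ L := (le_abs_self _).trans (hρ.abs_sub_le y x hadj.symm)
    rw [Set.indicator_of_mem (s := {z | ρ z < Real.exp n}) hx]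
    calc (logCutoff ρ n x - logCutoff ρ n y) ^ 2
        ≤ (L / ρ x / n) ^ 2 := by
          rw [← sq_abs]
          gcongr
          exact (abs_logCutoff_sub_le hx0 hxy).trans (by gcongr)
      _ = (L / n) ^ 2 * (ρ x ^ 2)⁻¹ := by ring
  · rw [logCutoff_eq_zero hn (not_lt.1 hx), logCutoff_eq_zero hn ((not_lt.1 hx).trans hxy),
      Set.indicator_of_notMem (s := {z | ρ z < Real.exp n}) hx]
    norm_num

theorem sq_logCutoff_sub_le (hρ : IsQuadraticGauge G ρ L C) {n : ℕ} (hn : n ≠ 0) {x y : V}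
    (hadj : G.Adj x y) :
    (logCutoff ρ n x - logCutoff ρ n y) ^ 2 ≤
      (L / n) ^ 2 * ({z | ρ z < Real.exp n}.indicator (fun z => (ρ z ^ 2)⁻¹) x +
        {z | ρ z < Real.exp n}.indicator (fun z => (ρ z ^ 2)⁻¹) y) := by
  have hnonneg : ∀ x, 0 ≤ {z | ρ z < Real.exp n}.indicator (fun z => (ρ z ^ 2)⁻¹) x :=
    Set.indicator_nonneg fun _ _ => by positivity
  rcases le_total (ρ x) (ρ y) with hxy | hyx
  · refine (hρ.sq_logCutoff_sub_le_of_le hn hadj hxy).trans ?_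
    gcongr
    exact le_add_of_nonneg_right (hnonneg y)
  · rw [← neg_sq, neg_sub]
    refine (hρ.sq_logCutoff_sub_le_of_le hn hadj.symm hyx).trans ?_
    gcongr
    exact le_add_of_nonneg_left (hnonneg x)

theorem tsum_dart_indicator_inv_sq_le (hρ : IsQuadraticGauge G ρ L C) (n : ℕ) :
    ∑' d : G.Dart, {z | ρ z < Real.exp n}.indicator (fun z => (ρ z ^ 2)⁻¹) d.fst ≤
      n * (C * Real.exp 1 ^ 2) := by
  have hfin := hρ.finite_lt (Real.exp n)
  calc ∑' d : G.Dart, {z | ρ z < Real.exp n}.indicator (fun z => (ρ z ^ 2)⁻¹) d.fst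
      = ∑ x ∈ hfin.toFinset,
          G.degree x * {z | ρ z < Real.exp n}.indicator (fun z => (ρ z ^ 2)⁻¹) x :=
        tsum_dart_fst_eq_sum_degree_mul fun x hx =>
          Set.indicator_of_notMem (fun hmem => hx (hfin.mem_toFinset.2 hmem)) _
    _ = ∑ x ∈ hfin.toFinset, G.degree x * (ρ x ^ 2)⁻¹ :=
        Finset.sum_congr rfl fun x hx => by
          rw [Set.indicator_of_mem (hfin.mem_toFinset.1 hx)]
    _ ≤ n * (C * Real.exp 1 ^ 2) :=
        hρ.sum_degree_mul_inv_sq_le fun x hx => hfin.mem_toFinset.1 hx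

theorem dirichletEnergy_logCutoff_le (hρ : IsQuadraticGauge G ρ L C) {n : ℕ} (hn : n ≠ 0) :
    dirichletEnergy G (logCutoff ρ n) ≤ 2 * L ^ 2 * C * Real.exp 1 ^ 2 / n := by
  let h : V → ℝ := {z | ρ z < Real.exp n}.indicator fun z => (ρ z ^ 2)⁻¹
  have hsupp : (support h).Finite :=
    (hρ.finite_lt (Real.exp n)).subset Set.support_indicator_subset
  have hfst : Summable fun d : G.Dart => h d.fst :=
    summable_dart_of_finite_support hsupp fun _ h₀ _ => h₀
  have hsnd : Summable fun d : G.Dart => h d.snd :=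
    summable_dart_of_finite_support hsupp fun _ _ h₀ => h₀
  calc dirichletEnergy G (logCutoff ρ n)
      ≤ ∑' d : G.Dart, (L / n) ^ 2 * (h d.fst + h d.snd) :=
        (summable_dart_of_finite_support (hρ.finite_support_logCutoff hn)
          fun d h₁ h₂ => by rw [h₁, h₂, sub_self, zero_pow two_ne_zero]).tsum_le_tsum
          (fun d => hρ.sq_logCutoff_sub_le hn d.adj) ((hfst.add hsnd).mul_left _)
    _ = (L / n) ^ 2 * (2 * ∑' d : G.Dart, h d.fst) := by
        rw [tsum_mul_left, hfst.tsum_add hsnd, tsum_dart_swap fun x _ => h x, two_mul]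
    _ ≤ (L / n) ^ 2 * (2 * (n * (C * Real.exp 1 ^ 2))) := by
        gcongr
        exact hρ.tsum_dart_indicator_inv_sq_le n
    _ = 2 * L ^ 2 * C * Real.exp 1 ^ 2 / n := by field_simp

theorem isParabolic (hρ : IsQuadraticGauge G ρ L C) : IsParabolic G := by
  refine ⟨fun n => logCutoff ρ (n + 1), fun n => hρ.finite_support_logCutoff n.succ_ne_zero,
    fun x => (tendsto_logCutoff ρ x).comp (tendsto_add_atTop_nat 1), ?_⟩
  have hbound : Tendsto (fun n : ℕ => 2 * L ^ 2 * C * Real.exp 1 ^ 2 / (n + 1 : ℕ)) atTop (𝓝 0) :=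
    (tendsto_const_nhds.div_atTop tendsto_natCast_atTop_atTop).comp (tendsto_add_atTop_nat 1)
  exact squeeze_zero (fun n => tsum_nonneg fun d => sq_nonneg _)
    (fun n => hρ.dirichletEnergy_logCutoff_le n.succ_ne_zero) hbound

end IsQuadraticGauge

end QuadraticGrowth

section SeparatedFamilies

open MeasureTheory Module

variable {ι E : Type*} [NormedAddCommGroup E] [NormedSpace ℝ E] [FiniteDimensional ℝ E]
  {c : ι → E} {δ : ℝ}

theorem card_le_of_separated_of_dist_le (hδ : 0 < δ)
    (hsep : Pairwise fun i j => δ ≤ dist (c i) (c j)) {p : E} {r : ℝ} (hr : 0 ≤ r)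
    {s : Finset ι} (hs : ∀ i ∈ s, dist (c i) p ≤ r) :
    (s.card : ℝ) ≤ (2 * r / δ + 1) ^ finrank ℝ E := by
  borelize E
  let μ : Measure E := Measure.addHaar
  have hball : ∀ (x : E) {t : ℝ}, 0 < t →
      μ.real (Metric.ball x t) = t ^ finrank ℝ E * μ.real (Metric.ball 0 1) := fun x t ht => by
    rw [measureReal_def, μ.addHaar_ball_of_pos x ht, ENNReal.toReal_mul,
      ENNReal.toReal_ofReal (by positivity), measureReal_def]
  have hunit : 0 < μ.real (Metric.ball 0 1) :=
    ENNReal.toReal_pos (Metric.measure_ball_pos μ _ one_pos).ne' measure_ball_lt_top.ne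
  have hdisj : (s : Set ι).PairwiseDisjoint fun i => Metric.ball (c i) (δ / 2) :=
    fun i _ j _ hij => Metric.ball_disjoint_ball ((add_halves δ).le.trans (hsep hij))
  have hsub : ⋃ i ∈ s, Metric.ball (c i) (δ / 2) ⊆ Metric.ball p (r + δ / 2) :=
    Set.iUnion₂_subset fun i hi => Metric.ball_subset_ball' (by linarith [hs i hi])
  have hvol : s.card * (δ / 2) ^ finrank ℝ E ≤ (r + δ / 2) ^ finrank ℝ E := by
    refine le_of_mul_le_mul_right ?_ hunit
    calc s.card * (δ / 2) ^ finrank ℝ E * μ.real (Metric.ball 0 1)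
        = ∑ i ∈ s, μ.real (Metric.ball (c i) (δ / 2)) := by
          simp only [hball _ (half_pos hδ), Finset.sum_const, nsmul_eq_mul, mul_assoc]
      _ = μ.real (⋃ i ∈ s, Metric.ball (c i) (δ / 2)) :=
          (measureReal_biUnion_finset hdisj fun i _ => measurableSet_ball).symm
      _ ≤ μ.real (Metric.ball p (r + δ / 2)) := measureReal_mono hsub measure_ball_lt_top.ne
      _ = (r + δ / 2) ^ finrank ℝ E * μ.real (Metric.ball 0 1) := hball p (by positivity)
  rw [← le_div_iff₀ (by positivity), ← div_pow] at hvol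
  exact hvol.trans_eq (by congr 1; field_simp)

theorem finite_dist_le_of_separated (hδ : 0 < δ)
    (hsep : Pairwise fun i j => δ ≤ dist (c i) (c j)) (p : E) (r : ℝ) :
    {i | dist (c i) p ≤ r}.Finite := by
  by_contra hinf
  have hr : 0 ≤ r := by
    obtain ⟨i, hi⟩ := Set.Infinite.nonempty hinf
    exact dist_nonneg.trans hi
  obtain ⟨s, hs, hcard⟩ := Set.Infinite.exists_subset_card_eq hinf
    (⌊(2 * r / δ + 1) ^ finrank ℝ E⌋₊ + 1)
  have hle := Nat.le_floor (card_le_of_separated_of_dist_le hδ hsep hr fun i hi => hs hi)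
  omega

variable {G : SimpleGraph ι} [G.LocallyFinite] {L : ℝ}

theorem degree_le_of_separated (hδ : 0 < δ) (hsep : Pairwise fun i j => δ ≤ dist (c i) (c j))
    (hlen : ∀ i j, G.Adj i j → dist (c i) (c j) ≤ L) (i : ι) :
    (G.degree i : ℝ) ≤ (2 * |L| / δ + 1) ^ finrank ℝ E := by
  rw [← G.card_neighborFinset_eq_degree]
  refine card_le_of_separated_of_dist_le (p := c i) hδ hsep (abs_nonneg L) fun j hj => ?_
  rw [dist_comm]
  exact (hlen i j ((G.mem_neighborFinset i j).1 hj)).trans (le_abs_self L)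

theorem isQuadraticGauge_one_add_norm (hE : finrank ℝ E ≤ 2) (hδ : 0 < δ)
    (hsep : Pairwise fun i j => δ ≤ dist (c i) (c j))
    (hlen : ∀ i j, G.Adj i j → dist (c i) (c j) ≤ L) :
    IsQuadraticGauge G (fun i => 1 + ‖c i‖) L
      ((2 / δ + 1) ^ 2 * (2 * |L| / δ + 1) ^ finrank ℝ E) where
  one_le i := le_add_of_nonneg_right (norm_nonneg _)
  abs_sub_le i j hadj := by
    rw [add_sub_add_left_eq_sub]
    exact (abs_norm_sub_norm_le _ _).trans ((dist_eq_norm _ _).ge.trans (hlen i j hadj))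
  finite_le r := (finite_dist_le_of_separated hδ hsep 0 r).subset fun i hi => by
    rw [Set.mem_ofPred_eq, dist_zero_right]
    exact (le_add_of_nonneg_left zero_le_one).trans hi
  sum_degree_le r hr s hs := by
    have hcard : (s.card : ℝ) ≤ ((2 / δ + 1) * r) ^ 2 := by
      calc (s.card : ℝ) ≤ (2 * r / δ + 1) ^ finrank ℝ E :=
            card_le_of_separated_of_dist_le (p := 0) hδ hsep (by linarith) fun i hi => by
              rw [dist_zero_right]
              linarith [hs i hi]
        _ ≤ (2 * r / δ + 1) ^ 2 := pow_le_pow_right₀ (le_add_of_nonneg_left (by positivity)) hE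
        _ ≤ ((2 / δ + 1) * r) ^ 2 := by
            gcongr
            rw [add_mul, one_mul, div_mul_eq_mul_div]
            gcongr
    calc ∑ i ∈ s, (G.degree i : ℝ)
        ≤ s.card * (2 * |L| / δ + 1) ^ finrank ℝ E := by
          rw [← nsmul_eq_mul]
          exact Finset.sum_le_card_nsmul s _ _ fun i _ => degree_le_of_separated hδ hsep hlen i
      _ ≤ ((2 / δ + 1) * r) ^ 2 * (2 * |L| / δ + 1) ^ finrank ℝ E := by gcongr
      _ = (2 / δ + 1) ^ 2 * (2 * |L| / δ + 1) ^ finrank ℝ E * r ^ 2 := by ring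

end SeparatedFamilies

section RandomWalk

open MeasureTheory ProbabilityTheory Preorder

open scoped ENNReal

variable {V : Type*} (G : SimpleGraph V) [G.LocallyFinite]

theorem lintegral_walkStep [MeasurableSpace V] [DiscreteMeasurableSpace V] {x : V}
    (hx : 0 < G.degree x) (g : V → ℝ≥0∞) :
    ∫⁻ z, g z ∂(G.walkStep x).toMeasure =
      (∑ z ∈ G.neighborFinset x, g z) * (G.degree x : ℝ≥0∞)⁻¹ := by
  have hne : (G.neighborFinset x).Nonempty := Finset.card_pos.1 hx
  rw [SimpleGraph.walkStep, dif_pos hne, ← PMF.restrict_toMeasure_support,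
    PMF.support_uniformOfFinset, lintegral_finset, Finset.sum_mul]
  refine Finset.sum_congr rfl fun z hz => ?_
  rw [PMF.toMeasure_apply_singleton _ _ (measurableSet_singleton z),
    PMF.uniformOfFinset_apply_of_mem hne hz, G.card_neighborFinset_eq_degree]

/-- The trajectories that do not visit `o` at any of the times `1, …, n`. -/
def avoidingSet (o : V) (n : ℕ) : Set (ℕ → V) := {ω | ∀ i, 1 ≤ i → i ≤ n → ω i ≠ o}

theorem avoidingSet_zero (o : V) : avoidingSet o 0 = Set.univ :=
  Set.eq_univ_of_forall fun _ _ hi hi0 => absurd (hi.trans hi0) one_pos.not_ge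

theorem avoidingSet_succ (o : V) (n : ℕ) :
    avoidingSet o (n + 1) = avoidingSet o n ∩ (fun ω => ω (n + 1)) ⁻¹' {o}ᶜ := by
  ext ω
  refine ⟨fun h => ⟨fun i hi hin => h i hi (hin.trans n.le_succ), h _ n.succ_pos le_rfl⟩,
    fun h i hi hin => ?_⟩
  rcases hin.lt_or_eq with hlt | rfl
  exacts [h.1 i hi (Nat.le_of_lt_succ hlt), h.2]

theorem antitone_avoidingSet (o : V) : Antitone (avoidingSet o) :=
  fun _ _ hmn _ hω i hi him => hω i hi (him.trans hmn)

section Law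

variable [MeasurableSpace V] [DiscreteMeasurableSpace V]

theorem measurableSet_piLE_avoidingSet (o : V) (n : ℕ) :
    MeasurableSet[Filtration.piLE (X := fun _ : ℕ => V) n] (avoidingSet o n) := by
  rw [Filtration.piLE_eq_comap_frestrictLe]
  refine ⟨{h | ∀ i : Finset.Iic n, 1 ≤ i.1 → h i ≠ o}, ?_, ?_⟩
  · simp only [Set.ofPred_forall]
    exact .iInter fun i => .iInter fun _ =>
      measurableSet_preimage (t := {o}ᶜ) (measurable_pi_apply i) .of_discrete
  · ext ω
    exact ⟨fun h i hi hin => h ⟨i, Finset.mem_Iic.2 hin⟩ hi,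
      fun h i hi => h i hi (Finset.mem_Iic.1 i.2)⟩

theorem measurableSet_avoidingSet (o : V) (n : ℕ) : MeasurableSet (avoidingSet o n) :=
  Filtration.piLE.le n _ (measurableSet_piLE_avoidingSet o n)

instance instIsProbabilityMeasureWalkLaw (x : V) : IsProbabilityMeasure (G.walkLaw x) := by
  unfold SimpleGraph.walkLaw
  infer_instance

theorem lintegral_walkLaw_zero (x : V) (g : V → ℝ≥0∞) :
    ∫⁻ ω, g (ω 0) ∂G.walkLaw x = g x := by
  let x₀ : Π _ : Finset.Iic 0, V := fun _ => x
  have hinit : (G.walkLaw x).map (frestrictLe 0) = Measure.dirac x₀ := by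
    rw [SimpleGraph.walkLaw, Kernel.traj_map_frestrictLe_apply, Kernel.partialTraj_self,
      Kernel.id_apply]
  have hg : Measurable fun h : Π _ : Finset.Iic 0, V => g (h ⟨0, Finset.mem_Iic.2 le_rfl⟩) :=
    (Measurable.of_discrete (f := g)).comp (measurable_pi_apply _)
  calc ∫⁻ ω, g (ω 0) ∂G.walkLaw x
      = ∫⁻ h, g (h ⟨0, Finset.mem_Iic.2 le_rfl⟩) ∂(G.walkLaw x).map (frestrictLe 0) :=
        (lintegral_map (g := frestrictLe (π := fun _ => V) 0) hg (measurable_frestrictLe 0)).symm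
    _ = g x := by rw [hinit, lintegral_dirac' x₀ hg]

theorem setLIntegral_walkLaw_succ (x : V) {n : ℕ} {A : Set (ℕ → V)}
    (hA : MeasurableSet[Filtration.piLE (X := fun _ : ℕ => V) n] A) (g : V → ℝ≥0∞) :
    ∫⁻ ω in A, g (ω (n + 1)) ∂G.walkLaw x =
      ∫⁻ ω in A, ∫⁻ z, g z ∂(G.walkStep (ω n)).toMeasure ∂G.walkLaw x := by
  rw [Filtration.piLE_eq_comap_frestrictLe] at hA
  obtain ⟨S, hS, rfl⟩ := hA
  have hg : Measurable g := .of_discrete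
  have hstep : Measurable fun y => ∫⁻ z, g z ∂(G.walkStep y).toMeasure := .of_discrete
  let κ : (n : ℕ) → Kernel (Π _ : Finset.Iic n, V) V := fun n => G.walkKernel n
  let x₀ : Π _ : Finset.Iic 0, V := fun _ => x
  let μ : Measure (Π _ : Finset.Iic n, V) := Kernel.partialTraj (X := fun _ => V) κ 0 n x₀
  have hpast : (G.walkLaw x).map (frestrictLe n) = μ :=
    Kernel.traj_map_frestrictLe_apply (X := fun _ => V) (κ := κ) 0 n x₀
  have hjoint : μ ⊗ₘ κ n = (G.walkLaw x).map fun ω => (frestrictLe n ω, ω (n + 1)) :=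
    Kernel.partialTraj_compProd_eq_map_traj (X := fun _ => V) (κ := κ) n.zero_le
  calc ∫⁻ ω in frestrictLe n ⁻¹' S, g (ω (n + 1)) ∂G.walkLaw x
      = ∫⁻ p in S ×ˢ Set.univ, g p.2 ∂(μ ⊗ₘ κ n) := by
        rw [hjoint, setLIntegral_map (hS.prod .univ) (by fun_prop) (by fun_prop),
          Set.mk_preimage_prod, Set.preimage_univ, Set.inter_univ]
    _ = ∫⁻ h in S, ∫⁻ z, g z ∂(G.walkStep (h ⟨n, Finset.mem_Iic.2 le_rfl⟩)).toMeasure ∂μ := by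
        rw [Measure.setLIntegral_compProd (by fun_prop) hS .univ]
        simp only [Measure.restrict_univ]
        rfl
    _ = ∫⁻ ω in frestrictLe n ⁻¹' S, ∫⁻ z, g z ∂(G.walkStep (ω n)).toMeasure ∂G.walkLaw x := by
        rw [← hpast]
        exact setLIntegral_map hS (hstep.comp (measurable_pi_apply _)) (measurable_frestrictLe n)

/-- The transition operator of the walk killed on visiting `o`, which sends `g` to the function
`x ↦ 𝔼ₓ[g (X₁); X₁ ≠ o]`. -/
noncomputable def killedStep (o : V) (g : V → ℝ≥0∞) (x : V) : ℝ≥0∞ :=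
  ∫⁻ z in {o}ᶜ, g z ∂(G.walkStep x).toMeasure

theorem setLIntegral_avoidingSet (o x : V) (n : ℕ) (g : V → ℝ≥0∞) :
    ∫⁻ ω in avoidingSet o n, g (ω n) ∂G.walkLaw x = (killedStep G o)^[n] g x := by
  induction n generalizing g with
  | zero =>
    rw [avoidingSet_zero, Measure.restrict_univ, lintegral_walkLaw_zero,
      Function.iterate_zero_apply]
  | succ n ih =>
    have hlast : MeasurableSet ((fun ω : ℕ → V => ω (n + 1)) ⁻¹' {o}ᶜ) :=
      measurableSet_preimage (measurable_pi_apply (n + 1)) .of_discrete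
    calc ∫⁻ ω in avoidingSet o (n + 1), g (ω (n + 1)) ∂G.walkLaw x
        = ∫⁻ ω in avoidingSet o n, ({o}ᶜ : Set V).indicator g (ω (n + 1)) ∂G.walkLaw x := by
          rw [avoidingSet_succ, Set.inter_comm, ← setLIntegral_indicator hlast]
          rfl
      _ = ∫⁻ ω in avoidingSet o n, killedStep G o g (ω n) ∂G.walkLaw x := by
          rw [setLIntegral_walkLaw_succ G x (measurableSet_piLE_avoidingSet o n)]
          simp only [killedStep, lintegral_indicator (MeasurableSet.of_discrete (s := {o}ᶜ))]
      _ = (killedStep G o)^[n + 1] g x := by rw [ih, Function.iterate_succ_apply]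

theorem walkLaw_avoidingSet (o x : V) (n : ℕ) :
    G.walkLaw x (avoidingSet o n) = (killedStep G o)^[n] 1 x := by
  rw [← setLIntegral_avoidingSet, ← setLIntegral_one]
  rfl

/-- The probability that the walk started at `x` does not visit `o` at any time `n ≥ 1`. -/
noncomputable def escapeProb (o x : V) : ℝ≥0∞ := G.walkLaw x {ω | ∀ n, 1 ≤ n → ω n ≠ o}

theorem escapeProb_le_one (o x : V) : escapeProb G o x ≤ 1 := prob_le_one

theorem escapeProb_eq_iInf (o x : V) :
    escapeProb G o x = ⨅ n, G.walkLaw x (avoidingSet o n) := by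
  rw [← (antitone_avoidingSet o).measure_iInter
    (fun n => (measurableSet_avoidingSet o n).nullMeasurableSet) ⟨0, measure_ne_top _ _⟩]
  refine congrArg (G.walkLaw x) (Set.ext fun ω => ?_)
  rw [Set.mem_iInter]
  exact ⟨fun h _ i hi _ => h i hi, fun h i hi => h i i hi le_rfl⟩

theorem escapeProb_eq_setLIntegral (o x : V) :
    escapeProb G o x = ∫⁻ z in {o}ᶜ, escapeProb G o z ∂(G.walkStep x).toMeasure := by
  have := PMF.toMeasure.isProbabilityMeasure (G.walkStep x)
  have hanti (z : V) : Antitone fun n => G.walkLaw z (avoidingSet o n) :=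
    fun _ _ hmn => measure_mono (antitone_avoidingSet o hmn)
  simp only [escapeProb_eq_iInf]
  calc ⨅ n, G.walkLaw x (avoidingSet o n)
      = ⨅ n, G.walkLaw x (avoidingSet o (n + 1)) := ((hanti x).iInf_nat_add 1).symm
    _ = ⨅ n, ∫⁻ z in {o}ᶜ, G.walkLaw z (avoidingSet o n) ∂(G.walkStep x).toMeasure := by
        simp only [walkLaw_avoidingSet, Function.iterate_succ_apply', killedStep]
    _ = ∫⁻ z in {o}ᶜ, ⨅ n, G.walkLaw z (avoidingSet o n) ∂(G.walkStep x).toMeasure :=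
        (lintegral_iInf (fun _ => .of_discrete) (fun _ _ hmn z => hanti z hmn)
          (((lintegral_mono fun z => prob_le_one).trans_lt (by simp)).ne)).symm

theorem indicator_escapeProb_le_one (o x : V) :
    ({o}ᶜ : Set V).indicator (escapeProb G o) x ≤ 1 :=
  (Set.indicator_le_self _ _ x).trans (escapeProb_le_one G o x)

theorem degree_mul_escapeProb (o : V) {x : V} (hx : 0 < G.degree x) :
    G.degree x * (escapeProb G o x).toReal =
      ∑ z ∈ G.neighborFinset x, (({o}ᶜ : Set V).indicator (escapeProb G o) z).toReal := by
  have hdeg : (G.degree x : ℝ) ≠ 0 := Nat.cast_ne_zero.2 hx.ne'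
  have hfin (z : V) : ({o}ᶜ : Set V).indicator (escapeProb G o) z ≠ ∞ :=
    ne_top_of_le_ne_top ENNReal.one_ne_top (indicator_escapeProb_le_one G o z)
  rw [escapeProb_eq_setLIntegral, ← lintegral_indicator .of_discrete, lintegral_walkStep G hx,
    ENNReal.toReal_mul, ENNReal.toReal_sum fun z _ => hfin z, ENNReal.toReal_inv,
    ENNReal.toReal_natCast, mul_comm, inv_mul_cancel_right₀ hdeg]

theorem isSuperharmonic_const_sub_escapeProb (hdeg : ∀ x, 0 < G.degree x) (o : V)
    (a : ℝ) :
    G.IsSuperharmonic fun x => a - (({o}ᶜ : Set V).indicator (escapeProb G o) x).toReal := by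
  intro x
  have hle : (({o}ᶜ : Set V).indicator (escapeProb G o) x).toReal ≤ (escapeProb G o x).toReal :=
    ENNReal.toReal_mono (ne_top_of_le_ne_top ENNReal.one_ne_top (escapeProb_le_one G o x))
      (Set.indicator_le_self _ _ x)
  simp only [SimpleGraph.combLaplacian, sub_sub_sub_cancel_left, Finset.sum_sub_distrib,
    Finset.sum_const, nsmul_eq_mul, G.card_neighborFinset_eq_degree,
    ← degree_mul_escapeProb G o (hdeg x)]
  exact sub_nonpos.2 (mul_le_mul_of_nonneg_left hle (Nat.cast_nonneg _))

end Law

theorem isRecurrent_of_isSuperharmonic_const (hdeg : ∀ x, 0 < G.degree x)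
    (hconst : ∀ f : V → ℝ, (∀ x, 0 < f x) → G.IsSuperharmonic f → ∀ x y, f x = f y) :
    G.IsRecurrent := by
  let _ : MeasurableSpace V := ⊤
  have _ : DiscreteMeasurableSpace V := ⟨fun _ => trivial⟩
  intro o
  let q : V → ℝ := fun x => (({o}ᶜ : Set V).indicator (escapeProb G o) x).toReal
  have hq_le_one (x : V) : q x ≤ 1 :=
    ENNReal.toReal_le_of_le_ofReal zero_le_one
      (by simpa only [ENNReal.ofReal_one] using indicator_escapeProb_le_one G o x)
  have hqo : q o = 0 := by simp [q]
  have hq (x : V) : q x = 0 := by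
    have := hconst (fun x => 2 - q x) (fun x => by linarith [hq_le_one x])
      (isSuperharmonic_const_sub_escapeProb G hdeg o 2) x o
    linarith
  have hescape : escapeProb G o o = 0 := by
    have hmean : G.degree o * (escapeProb G o o).toReal = 0 :=
      (degree_mul_escapeProb G o (hdeg o)).trans (Finset.sum_eq_zero fun z _ => hq z)
    have hreal : (escapeProb G o o).toReal = 0 :=
      (mul_eq_zero.1 hmean).resolve_left (Nat.cast_ne_zero.2 (hdeg o).ne')
    exact ((ENNReal.toReal_eq_zero_iff _).1 hreal).resolve_right
      (ne_top_of_le_ne_top ENNReal.one_ne_top (escapeProb_le_one G o o))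
  refine (measure_eq_zero_iff_ae_notMem.1 hescape).mono fun ω hω => ?_
  by_contra! hne
  exact hω hne

end RandomWalk

theorem mainTheorem5_general {V E : Type*} [Nontrivial V] [NormedAddCommGroup E] [NormedSpace ℝ E]
    [FiniteDimensional ℝ E] (hE : Module.finrank ℝ E ≤ 2) {G : SimpleGraph V} [G.LocallyFinite]
    (hconn : G.Connected) {c : V → E} {δ L : ℝ} (hδ : 0 < δ)
    (hsep : Pairwise fun x y => δ ≤ dist (c x) (c y))
    (hlen : ∀ x y, G.Adj x y → dist (c x) (c y) ≤ L) :
    G.IsRecurrent ∧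
      ∀ f : V → ℝ, (∀ x, 0 < f x) → G.IsSuperharmonic f → ∃ k : ℝ, ∀ x, f x = k := by
  have hG : IsParabolic G := (isQuadraticGauge_one_add_norm hE hδ hsep hlen).isParabolic
  have hconst : ∀ f : V → ℝ, (∀ x, 0 < f x) → G.IsSuperharmonic f → ∀ x y, f x = f y :=
    fun f hpos hf => hG.eq_of_isSuperharmonic hconn.preconnected hf hpos
  have hdeg : ∀ x, 0 < G.degree x := fun x => hconn.preconnected.degree_pos_of_nontrivial x
  obtain ⟨x₀⟩ := hconn.nonempty
  exact ⟨isRecurrent_of_isSuperharmonic_const G hdeg hconst,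
    fun f hpos hf => ⟨f x₀, fun x => hconst f hpos hf x x₀⟩⟩

theorem mainTheorem5 {V : Type*} [Infinite V] (P : PennyConfiguration V)
    (hconn : P.graph.Connected) (hdeg : P.HasBoundedFacialDegree) :
    P.graph.IsRecurrent ∧
      ∀ f : V → ℝ, (∀ x, 0 < f x) → P.graph.IsSuperharmonic f → ∃ c : ℝ, ∀ x, f x = c :=
  mainTheorem5_general (by simp) hconn one_pos (fun _ _ h => P.one_le_dist h)
    (fun _ _ h => le_of_eq h)
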